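/- **Definitions.** A signature $\Sigma$ is a set of operators, each with a rank in $\mathbb N$. $\mathsf T(\Sigma)$ denotes the closed terms (processes), $\Delta(\mathsf T(\Sigma))$ the discrete probability distributions on them, and $\delta(t)$ the Dirac distribution at $t$. Distribution terms are built from distribution variables and $\delta(t)$ ($t$ a term) by convex combinations $\sum_{i\in I}p_i\theta_i$ ($p_i\in(0,1]$, $\sum_i p_i=1$; $\theta_1\oplus_p\theta_2$ is $p\,\theta_1+(1-p)\theta_2$) and by operators $f(\theta_1,\dots,\theta_n)$; closed distribution terms denote distributions, where $f(\pi_1,\dots,\pi_n)$ is the image of the product distribution under $(t_1,\dots,t_n)\mapsto f(t_1,\dots,t_n)$. A PTSS (in PGSOS format) $P=(\Sigma,A,R)$ consists of a signature, a set $A$ of actions and a set $R$ of rules $$\frac{\{x_i\xrightarrow{a_{i,k}}\mu_{i,k}\}_{1\le i\le n,\,k\in K_i}\quad\{x_i\not\xrightarrow{b_{i,l}}\}_{1\le i\le n,\,l\in L_i}}{f(x_1,\dots,x_n)\xrightarrow{a}\theta}$$ with $f\in\Sigma$ of rank $n$, $K_i,L_i$ finite, the state variables $x_i$ pairwise different,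 the distribution variables $\mu_{i,k}$ pairwise different, and $\theta$ a distribution term with variables among the $x_i,\mu_{i,k}$, such that for all $f$ and $a$ only finitely many rules have operator $f$ and conclusion label $a$; rules are taken up to renaming of variables. Its induced model is the unique transition relation ${\to}\subseteq\mathsf T(\Sigma)\times A\times\Delta(\mathsf T(\Sigma))$ that contains exactly the conclusions of those closed instances of rules of $R$ whose premises hold in $\to$. A PTSS $P_2=(\Sigma_2,A,R_2)$ is a disjoint extension of $P_1=(\Sigma_1,A,R_1)$, written $P_1\sqsubseteq P_2$, if $\Sigma_1\subseteq\Sigma_2$, $R_1\subseteq R_2$ and every rule in $R_2\setminus R_1$ is for an operator outside $\Sigma_1$. Fix $\surd\in A$. The PTSS $P_{\mathrm{PA}}$ has the constants $0$, $\varepsilon$, the $n$-ary prefixes $a.\bigoplus_{i=1}^n[p_i]\_$ ($a\in A$, $n\ge1$, $p_i\in(0,1]$, $\sum_i p_i=1$) and the binary operators $;$, $+$, $+_p$, $\mid$, $|||$, $|||_p$ ($p\in(0,1)$), $\parallel_B$ ($B\subseteq A$), and the following rules, for all $a\in A$ subject to the side conditions: * $\varepsilon\xrightarrow{\surd}\delta(0)$;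 $\quad a.\bigoplus_i[p_i]x_i\xrightarrow{a}\sum_i p_i\delta(x_i)$; * $x;y\xrightarrow{a}\mu;\delta(y)$ if $x\xrightarrow{a}\mu$, $a\ne\surd$; $\quad x;y\xrightarrow{a}\nu$ if $x\xrightarrow{\surd}\mu$, $y\xrightarrow{a}\nu$; * $x+y\xrightarrow{a}\mu$ if $x\xrightarrow{a}\mu$; $\quad x+y\xrightarrow{a}\nu$ if $y\xrightarrow{a}\nu$; * $x+_py\xrightarrow{a}\mu$ if $x\xrightarrow{a}\mu$, $y\not\xrightarrow{a}$; $\quad x+_py\xrightarrow{a}\nu$ if $x\not\xrightarrow{a}$, $y\xrightarrow{a}\nu$; $\quad x+_py\xrightarrow{a}\mu\oplus_p\nu$ if $x\xrightarrow{a}\mu$, $y\xrightarrow{a}\nu$; * $x\mid y\xrightarrow{a}\mu\mid\nu$ if $x\xrightarrow{a}\mu$, $y\xrightarrow{a}\nu$, $a\ne\surd$; * $x\,|||\,y\xrightarrow{a}\mu\,|||\,\delta(y)$ if $x\xrightarrow{a}\mu$, $a\ne\surd$; $\quad x\,|||\,y\xrightarrow{a}\delta(x)\,|||\,\nu$ if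 $y\xrightarrow{a}\nu$, $a\neq\surd$; * $x\,|||_p\,y\xrightarrow{a}\mu\,|||_p\,\delta(y)$ if $x\xrightarrow{a}\mu$, $y\not\xrightarrow{a}$, $a\ne\surd$; $\quad x\,|||_p\,y\xrightarrow{a}\delta(x)\,|||_p\,\nu$ if $x\not\xrightarrow{a}$, $y\xrightarrow{a}\nu$, $a\ne\surd$; $\quad x\,|||_p\,y\xrightarrow{a}(\mu\,|||_p\,\delta(y))\oplus_p(\delta(x)\,|||_p\,\nu)$ if $x\xrightarrow{a}\mu$, $y\xrightarrow{a}\nu$, $a\ne\surd$; * $x\parallel_By\xrightarrow{a}\mu\parallel_B\nu$ if $x\xrightarrow{a}\mu$, $y\xrightarrow{a}\nu$, $a\in B\setminus\{\surd\}$; $\quad x\parallel_By\xrightarrow{a}\mu\parallel_B\delta(y)$ if $x\xrightarrow{a}\mu$, $a\notin B\cup\{\surd\}$; $\quad x\parallel_By\xrightarrow{a}\delta(x)\parallel_B\nu$ if $y\xrightarrow{a}\nu$, $a\notin B\cup\{\surd\}$; * for each operator $\star$ among $\mid,\ |||,\ |||_p,\ \parallel_B$: $\ x\star y\xrightarrow{\surd}\delta(0)$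 if $x\xrightarrow{\surd}\mu$, $y\xrightarrow{\surd}\nu$. For $d\colon\mathsf T(\Sigma)^2\to[0,1]$ let $\mathbf K(d)(\pi,\pi')=\min_\omega\sum_{t,t'}d(t,t')\,\omega(t,t')$, where $\omega$ ranges over the distributions on $\mathsf T(\Sigma)^2$ with marginals $\pi$ and $\pi'$. For $\lambda\in(0,1]$, a $\lambda$-bisimulation metric is a pseudometric $d\colon\mathsf T(\Sigma)^2\to[0,1]$ such that whenever $d(t,t')<1$ and $t\xrightarrow{a}\pi$, there is $t'\xrightarrow{a}\pi'$ with $\lambda\cdot\mathbf K(d)(\pi,\pi')\le d(t,t')$. **Proposition.** Let $P=(\Sigma,A,R)$ be any PTSS with $P_{\mathrm{PA}}\sqsubseteq P$ and let $\lambda\in(0,1]$. Then there is a smallest (for the pointwise order) $\lambda$-bisimulation metric $\mathbf d$ on $\mathsf T(\Sigma)$, the $\lambda$-bisimilarity metric of the induced model of $P$, and for all terms $s_i,t_i\in\mathsf T(\Sigma)$: (a) $\mathbf d\bigl(a.\bigoplus_{i=1}^n[p_i]s_i,\ a.\bigoplus_{i=1}^n[p_i]t_i\bigr)\le\lambda\cdot\sum_{i=1}^n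 p_i\,\mathbf d(s_i,t_i)$ for all $a\in A$, $n\ge1$ and $p_1,\dots,p_n\in(0,1]$ with $\sum_i p_i=1$; (b) $\mathbf d(s_1+s_2,\ t_1+t_2)\le\max(\mathbf d(s_1,t_1),\mathbf d(s_2,t_2))$; (c) $\mathbf d(s_1+_ps_2,\ t_1+_pt_2)\le\max(\mathbf d(s_1,t_1),\mathbf d(s_2,t_2))$ for all $p\in(0,1)$. -/

import Mathlib

open FirstOrder
open scoped ENNReal

noncomputable section

namespace PPA

universe u v w u₁ v₁

/-! ### Terms, distribution terms and their meaning

A signature is a first-order language: `L.Functions n` is the set of its operators of rank `n`,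
and relation symbols play no role. State terms over a set `V` of variables are `L.Term V`. -/

/-- Closed state terms (processes). -/
abbrev Proc (L : FirstOrder.Language.{u, v}) : Type u := L.Term Empty

/-- Distribution terms over state variables `V` and distribution variables `W`. In a convex
combination all weights are positive and sum to one, so the index set `I` is countable
(possibly infinite). -/
inductive DTerm (L : FirstOrder.Language.{u, v}) (V W : Type) : Type (max 1 u)
  | var (m : W) : DTerm L V W
  | dirac (t : L.Term V) : DTerm L V W
  | conv {I : Type} (p : PMF I) (hp : ∀ i, 0 < p i) (θ : I → DTerm L V W) : DTerm L V W
  | op {n : ℕ} (f : L.Functions n) (θ : Fin n → DTerm L V W) : DTerm L V W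

/-- Closed distribution terms. -/
abbrev CDTerm (L : FirstOrder.Language.{u, v}) : Type (max 1 u) := DTerm L Empty Empty

/-- Application of a substitution to a distribution term. -/
def DTerm.subst {L : FirstOrder.Language.{u, v}} {V W V' W' : Type}
    (σs : V → L.Term V') (σd : W → DTerm L V' W') : DTerm L V W → DTerm L V' W'
  | .var m => σd m
  | .dirac t => .dirac (t.subst σs)
  | .conv p hp θ => .conv p hp fun i => (θ i).subst σs σd
  | .op f θ => .op f fun i => (θ i).subst σs σd

/-- Translation of a distribution term along a map of signatures. -/
def DTerm.map {L : FirstOrder.Language.{u, v}} {L' : FirstOrder.Language.{u₁, v₁}} {V W : Type} (φ : L →ᴸ L') :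
    DTerm L V W → DTerm L' V W
  | .var m => .var m
  | .dirac t => .dirac (φ.onTerm t)
  | .conv p hp θ => .conv p hp fun i => (θ i).map φ
  | .op f θ => .op (φ.onFunction f) fun i => (θ i).map φ

/-- The product distribution on tuples; see `prodPMF_apply`. -/
def prodPMF {T : Type u} : {n : ℕ} → (Fin n → PMF T) → PMF (Fin n → T)
  | 0, _ => PMF.pure Fin.elim0
  | _ + 1, π => (π 0).bind fun t => (prodPMF fun i => π i.succ).map fun ts => Fin.cons t ts

theorem prodPMF_apply {T : Type u} {n : ℕ} (π : Fin n → PMF T) (ts : Fin n → T) :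
    prodPMF π ts = ∏ i, π i (ts i) := by
  induction n with
  | zero =>
    have h : ts = Fin.elim0 := Subsingleton.elim _ _
    subst h
    simp [prodPMF]
  | succ n ih =>
    classical
    rw [prodPMF, PMF.bind_apply, Fin.prod_univ_succ, tsum_eq_single (ts 0)]
    · congr 1
      rw [PMF.map_apply, tsum_eq_single (fun i => ts i.succ)]
      · have h : ts = Fin.cons (ts 0) fun i => ts i.succ := (Fin.cons_self_tail ts).symm
        rw [if_pos h, ih]
      · intro us hus
        rw [if_neg]
        intro h
        refine hus (funext fun i => ?_)
        rw [h]
        rfl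
    · intro t ht
      rw [PMF.map_apply, ENNReal.tsum_eq_zero.2, mul_zero]
      intro us
      rw [if_neg]
      rintro rfl
      exact ht rfl

/-- The distribution over processes denoted by a closed distribution term. -/
def CDTerm.denote {L : FirstOrder.Language.{u, v}} : CDTerm L → PMF (Proc L)
  | .var m => m.elim
  | .dirac t => PMF.pure t
  | .conv p _ θ => p.bind fun i => CDTerm.denote (θ i)
  | .op f θ => (prodPMF fun i => CDTerm.denote (θ i)).map fun ts => FirstOrder.Language.Term.func f ts

/-! ### PGSOS specifications and their models -/

/-- A PGSOS rule with source `f(x₁, …, xₙ)` and a given conclusion label, for an operator `f` of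
rank `n`. Rules are taken up to renaming of variables: the source variables are the elements of
`Fin n`, and the right-hand side of the `k`-th positive premise of `xᵢ` is the distribution
variable `⟨i, k⟩`. Hence the source variables are pairwise different, so are the distribution
variables, and no other variable occurs in the target. -/
structure Rule (L : FirstOrder.Language.{u, v}) (A : Type w) (n : ℕ) where
  /-- number of positive premises of each source variable -/
  numPos : Fin n → ℕ
  /-- labels of the positive premises -/
  posAct : (i : Fin n) → Fin (numPos i) → A
  /-- labels of the negative premises -/
  negAct : Fin n → Finset A
  /-- target of the conclusion -/
  target : DTerm L (Fin n) (Σ i, Fin (numPos i))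

/-- Translation of a rule along a map of signatures. -/
def Rule.map {L : FirstOrder.Language.{u, v}} {L' : FirstOrder.Language.{u₁, v₁}} {A : Type w} {n : ℕ} (φ : L →ᴸ L')
    (r : Rule L A n) : Rule L' A n :=
  ⟨r.numPos, r.posAct, r.negAct, r.target.map φ⟩

/-- A probabilistic transition system specification in PGSOS format: `rules f a` is the (finite)
set of the rules for the operator `f` whose conclusion is labelled `a`. -/
structure PTSS (L : FirstOrder.Language.{u, v}) (A : Type w) where
  rules : {n : ℕ} → L.Functions n → A → Set (Rule L A n)
  finite_rules : ∀ {n : ℕ} (f : L.Functions n) (a : A), (rules f a).Finite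

/-- Transition relations of PTSs: `tr t a π` means that `t` has an `a`-labelled transition
to `π`. -/
abbrev TransRel (L : FirstOrder.Language.{u, v}) (A : Type w) : Type (max u w) :=
  Proc L → A → PMF (Proc L) → Prop

/-- `f(t₁, …, tₙ)` can do an `a`-labelled transition to `π` by the instance of the rule `r` under
the closed substitution `xᵢ ↦ tᵢ`, `μ ↦ σ μ`, all premises being satisfied in `tr`. -/
def Rule.Derives {L : FirstOrder.Language.{u, v}} {A : Type w} {n : ℕ} (r : Rule L A n)
    (tr : TransRel L A) (ts : Fin n → Proc L) (σ : (Σ i, Fin (r.numPos i)) → CDTerm L)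
    (π : PMF (Proc L)) : Prop :=
  (∀ i k, tr (ts i) (r.posAct i k) (CDTerm.denote (σ ⟨i, k⟩))) ∧
  (∀ i, ∀ b ∈ r.negAct i, ∀ ρ, ¬ tr (ts i) b ρ) ∧
  π = CDTerm.denote (r.target.subst ts σ)

/-- The transition `t —a→ π` is justified in `tr` by some rule of `P`. -/
def PTSS.Supports {L : FirstOrder.Language.{u, v}} {A : Type w} (P : PTSS L A) (tr : TransRel L A)
    (t : Proc L) (a : A) (π : PMF (Proc L)) : Prop :=
  ∃ (n : ℕ) (f : L.Functions n) (ts : Fin n → Proc L), t = FirstOrder.Language.Term.func f ts ∧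
    ∃ r ∈ P.rules f a, ∃ σ, r.Derives tr ts σ π

/-- Supported models: they contain all and only the transitions that the rules justify. -/
def PTSS.IsSupportedModel {L : FirstOrder.Language.{u, v}} {A : Type w} (P : PTSS L A)
    (tr : TransRel L A) : Prop :=
  ∀ t a π, tr t a π ↔ P.Supports tr t a π

/-- Auxiliary recursion that constructs the supported model. -/
def PTSS.transAux {L : FirstOrder.Language.{u, v}} {A : Type w} (P : PTSS L A) :
    Proc L → A → PMF (Proc L) → Prop
  | .var e => e.elim
  | .func f ts => fun a π => ∃ r ∈ P.rules f a, ∃ σ : (Σ i, Fin (r.numPos i)) → CDTerm L,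
      (∀ i k, P.transAux (ts i) (r.posAct i k) (CDTerm.denote (σ ⟨i, k⟩))) ∧
      (∀ i, ∀ b ∈ r.negAct i, ∀ ρ, ¬ P.transAux (ts i) b ρ) ∧
      π = CDTerm.denote (r.target.subst ts σ)

theorem PTSS.existsUnique_isSupportedModel {L : FirstOrder.Language.{u, v}} {A : Type w} (P : PTSS L A) :
    ∃! tr : TransRel L A, P.IsSupportedModel tr := by
  have key : ∀ tr : TransRel L A, ∀ {n : ℕ} (f : L.Functions n) (ts : Fin n → Proc L) a π,
      P.Supports tr (.func f ts) a π ↔ ∃ r ∈ P.rules f a, ∃ σ, r.Derives tr ts σ π := by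
    intro tr n f ts a π
    constructor
    · rintro ⟨m, g, us, h, H⟩
      cases h
      exact H
    · intro H
      exact ⟨n, f, ts, rfl, H⟩
  refine ⟨P.transAux, ?_, ?_⟩
  · intro t a π
    cases t with
    | var e => exact e.elim
    | func f ts =>
      rw [key, PTSS.transAux]
      rfl
  · intro tr htr
    funext t
    induction t with
    | var e => exact e.elim
    | func f ts ih =>
      funext a π
      rw [eq_iff_iff, htr, key, PTSS.transAux]
      simp only [Rule.Derives, ih]

/-- The induced model of `P`: its unique supported model. -/
def PTSS.trans {L : FirstOrder.Language.{u, v}} {A : Type w} (P : PTSS L A) : TransRel L A :=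
  P.existsUnique_isSupportedModel.choose

/-- `P₂` is a disjoint extension of `P₁`, where `φ` is the inclusion of the signature of `P₁` in
that of `P₂`: for the operators of `P₁`, the rules of `P₂` are exactly those of `P₁`. -/
structure IsDisjointExtension {L₁ : FirstOrder.Language.{u, v}} {L₂ : FirstOrder.Language.{u₁, v₁}} {A : Type w}
    (φ : L₁ →ᴸ L₂) (P₁ : PTSS L₁ A) (P₂ : PTSS L₂ A) : Prop where
  injective : ∀ n : ℕ, Function.Injective fun f : L₁.Functions n => φ.onFunction f
  rules_eq : ∀ {n : ℕ} (f : L₁.Functions n) (a : A),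
    P₂.rules (φ.onFunction f) a = Rule.map φ '' P₁.rules f a

/-! ### Bisimulation metrics -/

/-- 1-bounded pseudometrics. -/
structure IsPseudometric {T : Type u} (d : T → T → ℝ≥0∞) : Prop where
  le_one : ∀ s t, d s t ≤ 1
  self : ∀ t, d t t = 0
  symm : ∀ s t, d s t = d t s
  triangle : ∀ s t r, d s t ≤ d s r + d r t

/-- `ω` is a matching for `(π, π')`. -/
def IsMatching {T : Type u} (π π' : PMF T) (ω : PMF (T × T)) : Prop :=
  (∀ t, ∑' t', ω (t, t') = π t) ∧ (∀ t', ∑' t, ω (t, t') = π' t')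

/-- The Kantorovich lifting (the infimum is a minimum). -/
def kantorovich {T : Type u} (d : T → T → ℝ≥0∞) (π π' : PMF T) : ℝ≥0∞ :=
  ⨅ (ω : PMF (T × T)) (_ : IsMatching π π' ω), ∑' q : T × T, d q.1 q.2 * ω q

/-- `lam`-bisimulation metrics. -/
structure IsBisimMetric {L : FirstOrder.Language.{u, v}} {A : Type w} (tr : TransRel L A) (lam : ℝ≥0∞)
    (d : Proc L → Proc L → ℝ≥0∞) : Prop where
  pseudometric : IsPseudometric d
  transfer : ∀ t t', d t t' < 1 → ∀ a π, tr t a π →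
    ∃ π', tr t' a π' ∧ lam * kantorovich d π π' ≤ d t t'

/-- The `lam`-bisimilarity metric of the induced model of `P`: the infimum, for the pointwise
order, of all `lam`-bisimulation metrics. (That it is itself a `lam`-bisimulation metric, hence
the smallest one, is a part of the theorem below.) -/
def PTSS.bisimDist {L : FirstOrder.Language.{u, v}} {A : Type w} (P : PTSS L A) (lam : ℝ≥0∞) :
    Proc L → Proc L → ℝ≥0∞ :=
  sInf {d | IsBisimMetric P.trans lam d}

/-! ### The process algebra -/

/-- The operators of the process algebra, by rank. -/
inductive PAOp (A : Type u) : ℕ → Type u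
  /-- `0` -/
  | nil : PAOp A 0
  /-- `ε` -/
  | skip : PAOp A 0
  /-- `a.([p₁]_ ⊕ … ⊕ [pₙ]_)`; a distribution on `Fin n` exists only for `n ≥ 1` -/
  | pre {n : ℕ} (a : A) (p : PMF (Fin n)) (hp : ∀ i, 0 < p i) : PAOp A n
  /-- `_ ; _` -/
  | seq : PAOp A 2
  /-- `_ + _` -/
  | alt : PAOp A 2
  /-- `_ +_p _` -/
  | palt (p : ℝ≥0∞) (h0 : 0 < p) (h1 : p < 1) : PAOp A 2
  /-- `_ | _` -/
  | sync : PAOp A 2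
  /-- `_ ||| _` -/
  | par : PAOp A 2
  /-- `_ |||_p _` -/
  | ppar (p : ℝ≥0∞) (h0 : 0 < p) (h1 : p < 1) : PAOp A 2
  /-- `_ ‖_B _` -/
  | csp (B : Set A) : PAOp A 2

/-- The signature of the process algebra. -/
abbrev paLang (A : Type u) : FirstOrder.Language.{u, 0} := ⟨PAOp A, fun _ => Empty⟩

/-- `θ₁ ⊕_p θ₂` -/
def DTerm.choice {L : FirstOrder.Language.{u, v}} {V W : Type} (p : ℝ≥0∞) (h0 : 0 < p) (h1 : p < 1)
    (θ₁ θ₂ : DTerm L V W) : DTerm L V W :=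
  .conv (PMF.ofFintype ![p, 1 - p] (by simp [h1.le]))
    (by simp [Fin.forall_fin_two, h0, h1]) ![θ₁, θ₂]

/-- `f(θ₁, θ₂)` -/
def paOp₂ {A : Type u} {V W : Type} (f : PAOp A 2) (θ₁ θ₂ : DTerm (paLang A) V W) :
    DTerm (paLang A) V W :=
  .op (L := paLang A) f ![θ₁, θ₂]

/-- `δ(0)` -/
def paDiracNil {A : Type u} {V W : Type} : DTerm (paLang A) V W :=
  .dirac (FirstOrder.Language.Term.func (L := paLang A) PAOp.nil Fin.elim0)

/-- The rule with the premises `x —a→ μ` and `y —b↛` for all `b ∈ N`; the target may use `μ`,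
`δ(x)` and `δ(y)`. -/
def ruleL {A : Type u} (a : A) (N : Finset A)
    (θ : {W : Type} → (μ δx δy : DTerm (paLang A) (Fin 2) W) → DTerm (paLang A) (Fin 2) W) :
    Rule (paLang A) A 2 where
  numPos := ![1, 0]
  posAct := fun _ _ => a
  negAct := ![∅, N]
  target := θ (.var ⟨0, (0 : Fin 1)⟩) (.dirac (.var 0)) (.dirac (.var 1))

/-- The rule with the premises `y —a→ ν` and `x —b↛` for all `b ∈ N`; the target may use `ν`,
`δ(x)` and `δ(y)`. -/
def ruleR {A : Type u} (a : A) (N : Finset A)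
    (θ : {W : Type} → (ν δx δy : DTerm (paLang A) (Fin 2) W) → DTerm (paLang A) (Fin 2) W) :
    Rule (paLang A) A 2 where
  numPos := ![0, 1]
  posAct := fun _ _ => a
  negAct := ![N, ∅]
  target := θ (.var ⟨1, (0 : Fin 1)⟩) (.dirac (.var 0)) (.dirac (.var 1))

/-- The rule with the premises `x —a→ μ` and `y —b→ ν`. -/
def ruleLR {A : Type u} (a b : A)
    (θ : {W : Type} → (μ ν δx δy : DTerm (paLang A) (Fin 2) W) → DTerm (paLang A) (Fin 2) W) :
    Rule (paLang A) A 2 where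
  numPos := fun _ => 1
  posAct := fun i _ => ![a, b] i
  negAct := fun _ => ∅
  target := θ (.var ⟨0, 0⟩) (.var ⟨1, 0⟩) (.dirac (.var 0)) (.dirac (.var 1))

/-- The rules of the process algebra; `tick` is the successful termination action. -/
def paRules {A : Type u} (tick : A) :
    {n : ℕ} → PAOp A n → A → Set (Rule (paLang A) A n)
  | _, .nil, _ => ∅
  | _, .skip, a => {r | a = tick ∧ r =
      { numPos := fun _ => 0, posAct := fun _ _ => a, negAct := fun _ => ∅,
        target := paDiracNil }}
  | _, .pre b p hp, a => {r | a = b ∧ r =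
      { numPos := fun _ => 0, posAct := fun _ _ => a, negAct := fun _ => ∅,
        target := .conv p hp fun i => .dirac (.var i) }}
  | _, .seq, a =>
      {r | a ≠ tick ∧ r = ruleL a ∅ fun μ _ δy => paOp₂ .seq μ δy} ∪
      {ruleLR tick a fun _ ν _ _ => ν}
  | _, .alt, a =>
      {ruleL a ∅ fun μ _ _ => μ} ∪
      {ruleR a ∅ fun ν _ _ => ν}
  | _, .palt p h0 h1, a =>
      {ruleL a {a} fun μ _ _ => μ} ∪
      {ruleR a {a} fun ν _ _ => ν} ∪
      {ruleLR a a fun μ ν _ _ => .choice p h0 h1 μ ν}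
  | _, .sync, a =>
      {r | a ≠ tick ∧ r = ruleLR a a fun μ ν _ _ => paOp₂ .sync μ ν} ∪
      {r | a = tick ∧ r = ruleLR tick tick fun _ _ _ _ => paDiracNil}
  | _, .par, a =>
      {r | a ≠ tick ∧ r = ruleL a ∅ fun μ _ δy => paOp₂ .par μ δy} ∪
      {r | a ≠ tick ∧ r = ruleR a ∅ fun ν δx _ => paOp₂ .par δx ν} ∪
      {r | a = tick ∧ r = ruleLR tick tick fun _ _ _ _ => paDiracNil}
  | _, .ppar p h0 h1, a =>
      {r | a ≠ tick ∧ r = ruleL a {a} fun μ _ δy => paOp₂ (.ppar p h0 h1) μ δy} ∪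
      {r | a ≠ tick ∧ r = ruleR a {a} fun ν δx _ => paOp₂ (.ppar p h0 h1) δx ν} ∪
      {r | a ≠ tick ∧ r = ruleLR a a fun μ ν δx δy =>
        .choice p h0 h1 (paOp₂ (.ppar p h0 h1) μ δy) (paOp₂ (.ppar p h0 h1) δx ν)} ∪
      {r | a = tick ∧ r = ruleLR tick tick fun _ _ _ _ => paDiracNil}
  | _, .csp B, a =>
      {r | (a ∈ B ∧ a ≠ tick) ∧ r = ruleLR a a fun μ ν _ _ => paOp₂ (.csp B) μ ν} ∪
      {r | a = tick ∧ r = ruleLR tick tick fun _ _ _ _ => paDiracNil} ∪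
      {r | (a ∉ B ∧ a ≠ tick) ∧ r = ruleL a ∅ fun μ _ δy => paOp₂ (.csp B) μ δy} ∪
      {r | (a ∉ B ∧ a ≠ tick) ∧ r = ruleR a ∅ fun ν δx _ => paOp₂ (.csp B) δx ν}

theorem finite_setOf_and_eq {α : Type*} (q : Prop) (b : α) : {r | q ∧ r = b}.Finite :=
  (Set.finite_singleton b).subset fun _ h => h.2

/-- The specification of the process algebra. -/
def paPTSS {A : Type u} (tick : A) : PTSS (paLang A) A where
  rules := fun f a => paRules tick (show PAOp A _ from f) a
  finite_rules := by
    intro n f a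
    cases (show PAOp A n from f) <;>
      simp only [paRules, Set.finite_union, finite_setOf_and_eq, Set.finite_singleton,
        Set.finite_empty, and_self]

end PPA

end

noncomputable section

namespace PPA

universe u v w

/-! ### The Kantorovich lifting -/

section Kantorovich

variable {T : Type u}

/-! The pseudometric axioms obstruct direct minimality arguments: changing a metric at one pair
destroys them. They are therefore dropped. A pre-bisimulation (`IsPreBisim`) is only 1-bounded and
satisfies the transfer condition in both directions. The PGSOS finiteness conditions give finitely
many derivatives per process and label (`PTSS.finite_trans`), so best answers exist and the
pointwise infimum of all pre-bisimulations is again one (`isPreBisim_leastPreBisim`).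
Pre-bisimulations are closed under swapping arguments, and the least one stays a pre-bisimulation
when its diagonal is zeroed or when it is composed with itself; minimality then yields symmetry,
reflexivity and the triangle inequality. Since every bisimulation metric is a pre-bisimulation, the
least pre-bisimulation is the least bisimulation metric.

Minimality also gives a proof principle (`leastPreBisim_le_of_simulates`): a distance is at most `c`
once each side answers every move of the other at cost at most `c`. For (a), couple the two targets
index by index. For (b) and (c), copy the answers of the components, mixing them when both move. The
negative premises of `+_p` transfer because distance below 1 forces equal enabled actions; if the
bound is 1 there is nothing to prove. -/

theorem kantorovich_mono {d d' : T → T → ℝ≥0∞} (h : ∀ s t, d s t ≤ d' s t) (π π' : PMF T) :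
    kantorovich d π π' ≤ kantorovich d' π π' :=
  iInf₂_mono fun _ _ => ENNReal.tsum_le_tsum fun _ => mul_le_mul_left (h _ _) _

theorem kantorovich_le_of_isMatching (d : T → T → ℝ≥0∞) {π π' : PMF T} {ω : PMF (T × T)}
    (h : IsMatching π π' ω) : kantorovich d π π' ≤ ∑' q : T × T, d q.1 q.2 * ω q :=
  iInf₂_le ω h

/-- A function with the marginals of two distributions is a distribution. -/
theorem kantorovich_le_of_marginals (d : T → T → ℝ≥0∞) {π π' : PMF T} (ω : T → T → ℝ≥0∞)
    (h₁ : ∀ t, ∑' t', ω t t' = π t) (h₂ : ∀ t', ∑' t, ω t t' = π' t') :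
    kantorovich d π π' ≤ ∑' t, ∑' t', d t t' * ω t t' := by
  have hs : HasSum (fun q : T × T => ω q.1 q.2) 1 := by
    have : ∑' q : T × T, ω q.1 q.2 = 1 := by
      rw [ENNReal.tsum_prod (f := ω)]
      simp only [h₁, PMF.tsum_coe]
    exact this ▸ ENNReal.summable.hasSum
  refine (kantorovich_le_of_isMatching d (ω := ⟨fun q => ω q.1 q.2, hs⟩) ⟨h₁, h₂⟩).trans ?_
  exact (ENNReal.tsum_prod (f := fun t t' => d t t' * ω t t')).le

theorem kantorovich_bind_pure (d : T → T → ℝ≥0∞) {I : Type} (p : PMF I) (s t : I → T) :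
    kantorovich d (p.bind fun i => PMF.pure (s i)) (p.bind fun i => PMF.pure (t i)) ≤
      ∑' i, p i * d (s i) (t i) := by
  classical
  -- The coupling puts mass `p i` on the pair `(s i, t i)`; coinciding pairs accumulate mass.
  refine (kantorovich_le_of_marginals d
    (fun x y => ∑' i, p i * (if x = s i then 1 else 0) * (if y = t i then 1 else 0)) ?_ ?_).trans ?_
  · intro x
    rw [ENNReal.tsum_comm]
    simp [PMF.bind_apply, PMF.pure_apply]
  · intro y
    rw [ENNReal.tsum_comm]
    simp only [ENNReal.tsum_mul_right]
    simp [PMF.bind_apply, PMF.pure_apply]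
  · simp only [← ENNReal.tsum_mul_left]
    refine le_of_eq ?_
    calc _ = ∑' x, ∑' i, ∑' y, d x y *
          (p i * (if x = s i then 1 else 0) * (if y = t i then 1 else 0)) :=
          tsum_congr fun x => ENNReal.tsum_comm
      _ = ∑' i, ∑' x, ∑' y, d x y *
          (p i * (if x = s i then 1 else 0) * (if y = t i then 1 else 0)) := ENNReal.tsum_comm
      _ = _ := by
        refine tsum_congr fun i => ?_
        rw [tsum_eq_single (s i) (by intro x hx; simp [hx]),
          tsum_eq_single (t i) (by intro y hy; simp [hy])]
        simp [mul_comm]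

theorem kantorovich_self {d : T → T → ℝ≥0∞} (h : ∀ t, d t t = 0) (π : PMF T) :
    kantorovich d π π = 0 := by
  classical
  refine le_antisymm ?_ zero_le
  -- Couple `π` with itself along the diagonal.
  refine (kantorovich_le_of_marginals d (fun x y => if x = y then π x else 0) ?_ ?_).trans ?_
  · intro x; simp
  · intro y; simp
  · refine le_of_eq (ENNReal.tsum_eq_zero.2 fun x => ENNReal.tsum_eq_zero.2 fun y => ?_)
    by_cases hxy : x = y
    · subst hxy; simp [h]
    · simp [hxy]

/-- The Kantorovich lifting preserves upper bounds under mixtures. -/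
theorem kantorovich_bind_le (d : T → T → ℝ≥0∞) {I : Type} (p : PMF I) (f g : I → PMF T)
    {c : ℝ≥0∞} (h : ∀ i, kantorovich d (f i) (g i) ≤ c) :
    kantorovich d (p.bind f) (p.bind g) ≤ c := by
  -- Near-optimal matchings suffice, so attainment of the infimum is not needed; their `p`-mixture
  -- is a matching of the mixtures.
  refine le_of_forall_gt_imp_ge_of_dense fun b hb => ?_
  have : ∀ i, ∃ ω, IsMatching (f i) (g i) ω ∧ ∑' q : T × T, d q.1 q.2 * ω q < b := by
    intro i
    have := (h i).trans_lt hb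
    simpa only [kantorovich, iInf_lt_iff, exists_prop] using this
  choose ω hω hb using this
  refine (kantorovich_le_of_isMatching d (ω := p.bind ω) ⟨?_, ?_⟩).trans ?_
  · intro t
    simp only [PMF.bind_apply]
    rw [ENNReal.tsum_comm]
    simp only [ENNReal.tsum_mul_left, (hω _).1]
  · intro t
    simp only [PMF.bind_apply]
    rw [ENNReal.tsum_comm]
    simp only [ENNReal.tsum_mul_left, (hω _).2]
  · calc ∑' q : T × T, d q.1 q.2 * p.bind ω q
        = ∑' i, p i * ∑' q : T × T, d q.1 q.2 * ω i q := by
          simp only [PMF.bind_apply, ← ENNReal.tsum_mul_left]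
          rw [ENNReal.tsum_comm]
          exact tsum_congr fun i => tsum_congr fun q => mul_left_comm _ _ _
      _ ≤ ∑' i, p i * b := ENNReal.tsum_le_tsum fun i => mul_le_mul_right (hb i).le _
      _ = b := by rw [ENNReal.tsum_mul_right, PMF.tsum_coe, one_mul]

/-- Gluing of matchings along a common marginal. -/
theorem kantorovich_triangle {d d₁ d₂ : T → T → ℝ≥0∞}
    (h : ∀ x y z, d x z ≤ d₁ x y + d₂ y z) (π ρ π' : PMF T) :
    kantorovich d π π' ≤ kantorovich d₁ π ρ + kantorovich d₂ ρ π' := by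
  simp only [kantorovich, ENNReal.iInf_add, ENNReal.add_iInf]
  refine le_iInf₂ fun ω₂ h₂ => le_iInf₂ fun ω₁ h₁ => ?_
  -- Conditionally independent gluing given `y`. Where `ρ y = 0` the inverse is `∞`, but the
  -- marginal conditions make both other factors vanish there.
  set τ : T → T → T → ℝ≥0∞ := fun x y z => ω₁ (x, y) * ω₂ (y, z) * (ρ y)⁻¹ with hτ
  have e₁ : ∀ x y, ∑' z, τ x y z = ω₁ (x, y) := by
    intro x y
    simp only [hτ, ENNReal.tsum_mul_right, ENNReal.tsum_mul_left, h₂.1]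
    by_cases h0 : ρ y = 0
    · have := h₁.2 y
      rw [h0, ENNReal.tsum_eq_zero] at this
      simp [this]
    · rw [mul_assoc, ENNReal.mul_inv_cancel h0 (ρ.apply_ne_top y), mul_one]
  have e₂ : ∀ y z, ∑' x, τ x y z = ω₂ (y, z) := by
    intro y z
    simp only [hτ, ENNReal.tsum_mul_right, h₁.2]
    by_cases h0 : ρ y = 0
    · have := h₂.1 y
      rw [h0, ENNReal.tsum_eq_zero] at this
      simp [this]
    · rw [mul_right_comm, ENNReal.mul_inv_cancel h0 (ρ.apply_ne_top y), one_mul]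
  refine (kantorovich_le_of_marginals d (fun x z => ∑' y, τ x y z) ?_ ?_).trans ?_
  · intro x
    rw [ENNReal.tsum_comm]
    simp only [e₁, h₁.1]
  · intro z
    rw [ENNReal.tsum_comm]
    simp only [e₂, h₂.2]
  · calc ∑' x, ∑' z, d x z * ∑' y, τ x y z
        ≤ ∑' x, ∑' z, ∑' y, (d₁ x y * τ x y z + d₂ y z * τ x y z) := by
          simp only [← ENNReal.tsum_mul_left, ← add_mul]
          gcongr
          exact h _ _ _
      _ = ∑' x, ∑' y, ∑' z, d₁ x y * τ x y z + ∑' y, ∑' z, ∑' x, d₂ y z * τ x y z := by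
          simp only [ENNReal.tsum_add]
          congr 1
          · exact tsum_congr fun x => ENNReal.tsum_comm
          · rw [ENNReal.tsum_comm]
            rw [ENNReal.tsum_comm (f := fun y z => ∑' x, d₂ y z * τ x y z)]
            exact tsum_congr fun z => ENNReal.tsum_comm
      _ = ∑' q : T × T, d₁ q.1 q.2 * ω₁ q + ∑' q : T × T, d₂ q.1 q.2 * ω₂ q := by
          simp only [ENNReal.tsum_mul_left, e₁, e₂]
          rw [← ENNReal.tsum_prod (f := fun x y => d₁ x y * ω₁ (x, y)),
            ← ENNReal.tsum_prod (f := fun x y => d₂ x y * ω₂ (x, y))]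

end Kantorovich

/-! ### The smallest bisimulation metric of an image-finite transition relation -/

section Bisim

variable {L : FirstOrder.Language.{u, v}} {A : Type w} {tr : TransRel L A} {lam : ℝ≥0∞}
  {d : Proc L → Proc L → ℝ≥0∞}

/-- Every transition of `t` is matched by one of `t'` within distance `c`. -/
def Simulates (tr : TransRel L A) (lam : ℝ≥0∞) (d : Proc L → Proc L → ℝ≥0∞) (c : ℝ≥0∞)
    (t t' : Proc L) : Prop :=
  ∀ a π, tr t a π → ∃ π', tr t' a π' ∧ lam * kantorovich d π π' ≤ c

theorem Simulates.mono {d' : Proc L → Proc L → ℝ≥0∞} {c c' : ℝ≥0∞} {t t' : Proc L}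
    (h : Simulates tr lam d c t t') (hd : ∀ x y, d' x y ≤ d x y) (hc : c ≤ c') :
    Simulates tr lam d' c' t t' := by
  intro a π hπ
  obtain ⟨π', hπ', hle⟩ := h a π hπ
  exact ⟨π', hπ', (mul_le_mul_right (kantorovich_mono hd _ _) _).trans (hle.trans hc)⟩

/-- Bisimulation metrics without the pseudometric axioms. -/
structure IsPreBisim (tr : TransRel L A) (lam : ℝ≥0∞) (d : Proc L → Proc L → ℝ≥0∞) : Prop where
  le_one : ∀ s t, d s t ≤ 1
  left : ∀ t t', d t t' < 1 → Simulates tr lam d (d t t') t t'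
  right : ∀ t t', d t t' < 1 → Simulates tr lam (fun x y => d y x) (d t t') t' t

theorem IsBisimMetric.isPreBisim (h : IsBisimMetric tr lam d) : IsPreBisim tr lam d where
  le_one := h.pseudometric.le_one
  left := h.transfer
  right t t' ht := by
    have e : (fun x y => d y x) = d := funext₂ fun x y => h.pseudometric.symm y x
    rw [e, h.pseudometric.symm t t']
    exact h.transfer t' t (h.pseudometric.symm t t' ▸ ht)

theorem IsPreBisim.swap (h : IsPreBisim tr lam d) : IsPreBisim tr lam fun x y => d y x where
  le_one s t := h.le_one t s
  left t t' ht := h.right t' t ht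
  right t t' ht := h.left t' t ht

/-- The pointwise infimum of all pre-bisimulations. -/
def leastPreBisim (tr : TransRel L A) (lam : ℝ≥0∞) : Proc L → Proc L → ℝ≥0∞ :=
  sInf {d | IsPreBisim tr lam d}

theorem leastPreBisim_le (h : IsPreBisim tr lam d) (s t : Proc L) :
    leastPreBisim tr lam s t ≤ d s t :=
  sInf_le (a := d) h s t

theorem leastPreBisim_apply (s t : Proc L) :
    leastPreBisim tr lam s t = ⨅ d : {d | IsPreBisim tr lam d}, d.1 s t := by
  rw [leastPreBisim, sInf_apply, iInf_apply]

theorem isPreBisim_one : IsPreBisim tr lam fun _ _ => 1 where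
  le_one _ _ := le_rfl
  left _ _ h := (lt_irrefl _ h).elim
  right _ _ h := (lt_irrefl _ h).elim

/-- With finitely many candidate answers, one of least cost serves for all `b > c` simultaneously,
hence for `c`. -/
theorem simulates_of_forall_lt {c : ℝ≥0∞} {t t' : Proc L} (hfin : ∀ t a, {π | tr t a π}.Finite)
    (hc : c < 1) (h : ∀ b, c < b → b < 1 → Simulates tr lam d b t t') :
    Simulates tr lam d c t t' := by
  intro a π hπ
  have hne : {π' | tr t' a π'}.Nonempty := by
    obtain ⟨b, hb, hb1⟩ := exists_between hc
    obtain ⟨π', hπ', -⟩ := h b hb hb1 a π hπ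
    exact ⟨π', hπ'⟩
  obtain ⟨π', hπ', hmin⟩ :=
    Set.exists_min_image _ (fun π' => lam * kantorovich d π π') (hfin t' a) hne
  refine ⟨π', hπ', le_of_forall_gt_imp_ge_of_dense fun b hb => ?_⟩
  obtain ⟨e, he, he'⟩ := exists_between (lt_min hb hc)
  obtain ⟨π'', hπ'', hle⟩ := h e he (he'.trans_le (min_le_right _ _)) a π hπ
  exact (hmin _ hπ'').trans (hle.trans (he'.trans_le (min_le_left _ _)).le)

/-- Whenever the infimum at a pair is below `b`, some pre-bisimulation is below `b` there; its
answers remain valid since lowering `d` only lowers Kantorovich costs. -/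
theorem isPreBisim_leastPreBisim (hfin : ∀ t a, {π | tr t a π}.Finite) :
    IsPreBisim tr lam (leastPreBisim tr lam) where
  le_one := leastPreBisim_le isPreBisim_one
  left t t' ht := by
    refine simulates_of_forall_lt hfin ht fun b hb hb1 => ?_
    rw [leastPreBisim_apply, iInf_lt_iff] at hb
    obtain ⟨⟨d, hd⟩, hdb⟩ := hb
    exact (hd.left t t' (hdb.trans hb1)).mono (leastPreBisim_le hd) hdb.le
  right t t' ht := by
    refine simulates_of_forall_lt hfin ht fun b hb hb1 => ?_
    rw [leastPreBisim_apply, iInf_lt_iff] at hb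
    obtain ⟨⟨d, hd⟩, hdb⟩ := hb
    exact (hd.right t t' (hdb.trans hb1)).mono (fun x y => leastPreBisim_le hd y x) hdb.le

/-- Distances in the least pre-bisimulation can be bounded by one step of the simulation game. -/
theorem leastPreBisim_le_of_simulates (hfin : ∀ t a, {π | tr t a π}.Finite) {c : ℝ≥0∞}
    {t t' : Proc L}
    (h₁ : c < 1 → Simulates tr lam (leastPreBisim tr lam) c t t')
    (h₂ : c < 1 → Simulates tr lam (fun x y => leastPreBisim tr lam y x) c t' t) :
    leastPreBisim tr lam t t' ≤ c := by
  classical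
  set m := leastPreBisim tr lam with hm
  have H : IsPreBisim tr lam m := isPreBisim_leastPreBisim hfin
  by_contra! hlt
  have hc : c < 1 := hlt.trans_le (H.le_one _ _)
  -- Lowering the least pre-bisimulation to `c` at the one pair `(t, t')` would give a smaller
  -- pre-bisimulation.
  set d : Proc L → Proc L → ℝ≥0∞ := fun x y => if x = t ∧ y = t' then c else m x y with hd
  have hdm : ∀ x y, d x y ≤ m x y := by
    intro x y
    by_cases hxy : x = t ∧ y = t'
    · rw [hd]
      simp only [if_pos hxy]
      rw [hxy.1, hxy.2]
      exact hlt.le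
    · simp [hd, if_neg hxy]
  have hdp : IsPreBisim tr lam d := by
    refine ⟨fun x y => (hdm x y).trans (H.le_one x y), fun x y hxy => ?_, fun x y hxy => ?_⟩
    · by_cases e : x = t ∧ y = t'
      · obtain ⟨rfl, rfl⟩ := e
        exact (h₁ hc).mono hdm (by simp [hd])
      · have e' : d x y = m x y := by simp [hd, if_neg e]
        rw [e'] at hxy ⊢
        exact (H.left x y hxy).mono hdm le_rfl
    · by_cases e : x = t ∧ y = t'
      · obtain ⟨rfl, rfl⟩ := e
        exact (h₂ hc).mono (fun x y => hdm y x) (by simp [hd])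
      · have e' : d x y = m x y := by simp [hd, if_neg e]
        rw [e'] at hxy ⊢
        exact (H.right x y hxy).mono (fun x y => hdm y x) le_rfl
  have := leastPreBisim_le hdp t t'
  simp only [hd, and_self, if_true] at this
  exact absurd this (not_le.2 hlt)

/-! ### Pseudometric axioms for the least pre-bisimulation. -/

theorem leastPreBisim_symm (hfin : ∀ t a, {π | tr t a π}.Finite) (s t : Proc L) :
    leastPreBisim tr lam s t = leastPreBisim tr lam t s :=
  le_antisymm (leastPreBisim_le (isPreBisim_leastPreBisim hfin).swap s t)
    (leastPreBisim_le (isPreBisim_leastPreBisim hfin).swap t s)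

theorem leastPreBisim_self (hfin : ∀ t a, {π | tr t a π}.Finite) (t : Proc L) :
    leastPreBisim tr lam t t = 0 := by
  classical
  set m := leastPreBisim tr lam with hm
  have H : IsPreBisim tr lam m := isPreBisim_leastPreBisim hfin
  -- Zeroing the diagonal preserves the game: a process answers itself with the same transition, at
  -- Kantorovich cost 0.
  set d : Proc L → Proc L → ℝ≥0∞ := fun x y => if x = y then 0 else m x y with hd
  have hself : ∀ x, d x x = 0 := fun x => by simp [hd]
  have hdm : ∀ x y, d x y ≤ m x y := by
    intro x y
    by_cases h : x = y <;> simp [hd, h]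
  have hdp : IsPreBisim tr lam d := by
    refine ⟨fun x y => (hdm x y).trans (H.le_one x y), fun x y hxy => ?_, fun x y hxy => ?_⟩
    · by_cases e : x = y
      · subst e
        exact fun a π hπ => ⟨π, hπ, by simp [kantorovich_self hself]⟩
      · have e' : d x y = m x y := by simp [hd, if_neg e]
        rw [e'] at hxy ⊢
        exact (H.left x y hxy).mono hdm le_rfl
    · by_cases e : x = y
      · subst e
        exact fun a π hπ => ⟨π, hπ, by
          simp [kantorovich_self (d := fun x y => d y x) hself]⟩
      · have e' : d x y = m x y := by simp [hd, if_neg e]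
        rw [e'] at hxy ⊢
        exact (H.right x y hxy).mono (fun x y => hdm y x) le_rfl
  exact le_antisymm ((leastPreBisim_le hdp t t).trans_eq (hself t)) zero_le

theorem Simulates.comp {d₁ d₂ : Proc L → Proc L → ℝ≥0∞} {c₁ c₂ : ℝ≥0∞} {s r t : Proc L}
    (h₁ : Simulates tr lam d₁ c₁ s r) (h₂ : Simulates tr lam d₂ c₂ r t)
    (hd : ∀ x y z, d x z ≤ d₁ x y + d₂ y z) : Simulates tr lam d (c₁ + c₂) s t := by
  intro a π hπ
  obtain ⟨ρ, hρ, hle₁⟩ := h₁ a π hπ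
  obtain ⟨π', hπ', hle₂⟩ := h₂ a ρ hρ
  refine ⟨π', hπ', ?_⟩
  calc lam * kantorovich d π π'
      ≤ lam * (kantorovich d₁ π ρ + kantorovich d₂ ρ π') :=
        mul_le_mul_right (kantorovich_triangle hd _ _ _) _
    _ ≤ c₁ + c₂ := by rw [mul_add]; exact add_le_add hle₁ hle₂

theorem leastPreBisim_triangle (hfin : ∀ t a, {π | tr t a π}.Finite) (s t r : Proc L) :
    leastPreBisim tr lam s t ≤ leastPreBisim tr lam s r + leastPreBisim tr lam r t := by
  set m := leastPreBisim tr lam with hm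
  have H : IsPreBisim tr lam m := isPreBisim_leastPreBisim hfin
  -- The best detour through a midpoint; it suffices that this is a pre-bisimulation. The midpoint
  -- `y = x` and the zero diagonal give its bound by 1.
  set d : Proc L → Proc L → ℝ≥0∞ := fun x z => ⨅ y, m x y + m y z with hd
  have hle : ∀ x y z, d x z ≤ m x y + m y z := fun x y z => iInf_le _ y
  have hself : ∀ x, m x x = 0 := leastPreBisim_self hfin
  have hdp : IsPreBisim tr lam d := by
    refine ⟨fun x y => (hle x x y).trans (by rw [hself, zero_add]; exact H.le_one x y),
      fun x z hxz => ?_, fun x z hxz => ?_⟩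
    · refine simulates_of_forall_lt hfin hxz fun b hb hb1 => ?_
      obtain ⟨y, hy⟩ := iInf_lt_iff.1 hb
      have h₁ := H.left x y ((le_self_add.trans_lt hy).trans hb1)
      have h₂ := H.left y z ((le_add_self.trans_lt hy).trans hb1)
      exact (h₁.comp h₂ hle).mono (fun _ _ => le_rfl) hy.le
    · refine simulates_of_forall_lt hfin hxz fun b hb hb1 => ?_
      obtain ⟨y, hy⟩ := iInf_lt_iff.1 hb
      have h₁ := H.right x y ((le_self_add.trans_lt hy).trans hb1)
      have h₂ := H.right y z ((le_add_self.trans_lt hy).trans hb1)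
      -- In the reverse game the answer passes from `z` to `y` to `x`, so the composition order
      -- flips.
      refine (h₂.comp h₁ (d := fun x y => d y x) fun x y z => ?_).mono (fun _ _ => le_rfl) ?_
      · exact (hle z y x).trans_eq (add_comm _ _)
      · rw [add_comm]; exact hy.le
  exact (leastPreBisim_le hdp s t).trans (hle s r t)

theorem isLeast_isBisimMetric (hfin : ∀ t a, {π | tr t a π}.Finite) :
    IsLeast {d | IsBisimMetric tr lam d} (leastPreBisim tr lam) := by
  have H := isPreBisim_leastPreBisim (tr := tr) (lam := lam) hfin
  refine ⟨⟨⟨H.le_one, leastPreBisim_self hfin, leastPreBisim_symm hfin,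
    leastPreBisim_triangle hfin⟩, H.left⟩, fun d hd => leastPreBisim_le hd.isPreBisim⟩

end Bisim

/-! ### Transitions of induced models -/

section Model

variable {L : FirstOrder.Language.{u, v}} {A : Type w}

/-- Denotation is compositional. Hence the infinitely many closed terms denoting the same premise
targets yield one conclusion. -/
theorem CDTerm.denote_subst_congr {V W : Type} (σs : V → Proc L) {σ σ' : W → CDTerm L}
    (h : ∀ m, CDTerm.denote (σ m) = CDTerm.denote (σ' m)) (θ : DTerm L V W) :
    CDTerm.denote (θ.subst σs σ) = CDTerm.denote (θ.subst σs σ') := by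
  induction θ with
  | var m => exact h m
  | dirac t => rfl
  | conv p hp θ ih => simp only [DTerm.subst, CDTerm.denote, ih]
  | op f θ ih => simp only [DTerm.subst, CDTerm.denote, ih]

theorem PTSS.isSupportedModel_trans (P : PTSS L A) : P.IsSupportedModel P.trans :=
  P.existsUnique_isSupportedModel.choose_spec.1

theorem PTSS.trans_func_iff (P : PTSS L A) {n : ℕ} (f : L.Functions n) (ts : Fin n → Proc L)
    (a : A) (π : PMF (Proc L)) :
    P.trans (.func f ts) a π ↔ ∃ r ∈ P.rules f a, ∃ σ, r.Derives P.trans ts σ π := by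
  rw [P.isSupportedModel_trans (.func f ts) a π]
  constructor
  · rintro ⟨m, g, us, h, H⟩
    cases h
    exact H
  · intro H
    exact ⟨n, f, ts, rfl, H⟩

/-- Rule instances substitute closed distribution terms for distribution variables, so a transition
can feed a premise only if its target is denoted by such a term. -/
theorem PTSS.exists_denote_of_trans (P : PTSS L A) {t : Proc L} {a : A} {π : PMF (Proc L)}
    (h : P.trans t a π) : ∃ θ : CDTerm L, CDTerm.denote θ = π := by
  obtain ⟨n, f, ts, -, r, -, σ, -, -, rfl⟩ :=
    (P.isSupportedModel_trans t a π).1 h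
  exact ⟨_, rfl⟩

/-- By induction on `t`: finitely many rules apply, each with finitely many premises, and each
premise has finitely many targets. -/
theorem PTSS.finite_trans (P : PTSS L A) (t : Proc L) (a : A) : {π | P.trans t a π}.Finite := by
  classical
  induction t generalizing a with
  | var e => exact e.elim
  | func f ts ih =>
    have hsub : {π | P.trans (.func f ts) a π} ⊆ ⋃ r ∈ P.rules f a,
        {π | ∃ σ, Rule.Derives r P.trans ts σ π} := by
      intro π hπ
      obtain ⟨r, hr, σ, h⟩ := (P.trans_func_iff f ts a π).1 hπ
      exact Set.mem_biUnion hr ⟨σ, h⟩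
    refine ((P.finite_rules f a).biUnion fun r _ => ?_).subset hsub
    have hpi : {g : (Σ i, Fin (r.numPos i)) → PMF (Proc L) |
        ∀ q, P.trans (ts q.1) (r.posAct q.1 q.2) (g q)}.Finite :=
      Set.Finite.pi' fun q => ih q.1 (r.posAct q.1 q.2)
    -- The conclusion is a function `F` of the tuple `g` of premise targets; tuples that no terms
    -- denote get an arbitrary value.
    have hex : ∀ g : (Σ i, Fin (r.numPos i)) → PMF (Proc L), ∃ π : PMF (Proc L),
        ∀ σ : (Σ i, Fin (r.numPos i)) → CDTerm L, (∀ q, CDTerm.denote (σ q) = g q) →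
          CDTerm.denote (r.target.subst ts σ) = π := by
      intro g
      by_cases hg : ∃ σ : (Σ i, Fin (r.numPos i)) → CDTerm L, ∀ q, CDTerm.denote (σ q) = g q
      · obtain ⟨σ, hσ⟩ := hg
        exact ⟨_, fun σ' hσ' => CDTerm.denote_subst_congr ts
          (fun q => (hσ' q).trans (hσ q).symm) r.target⟩
      · exact ⟨PMF.pure (.func f ts), fun σ hσ => (hg ⟨σ, hσ⟩).elim⟩
    choose F hF using hex
    refine (hpi.image F).subset ?_
    rintro π ⟨σ, hpos, -, rfl⟩
    exact ⟨fun q => CDTerm.denote (σ q), fun q => hpos q.1 q.2, (hF _ σ fun _ => rfl).symm⟩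

theorem PTSS.bisimDist_eq_leastPreBisim (P : PTSS L A) (lam : ℝ≥0∞) :
    P.bisimDist lam = leastPreBisim P.trans lam :=
  (isLeast_isBisimMetric P.finite_trans).isGLB.sInf_eq

theorem PTSS.isLeast_bisimDist (P : PTSS L A) (lam : ℝ≥0∞) :
    IsLeast {d | IsBisimMetric P.trans lam d} (P.bisimDist lam) :=
  P.bisimDist_eq_leastPreBisim lam ▸ isLeast_isBisimMetric P.finite_trans

theorem PTSS.bisimDist_symm (P : PTSS L A) (lam : ℝ≥0∞) (s t : Proc L) :
    P.bisimDist lam s t = P.bisimDist lam t s :=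
  (P.isLeast_bisimDist lam).1.pseudometric.symm s t

theorem PTSS.bisimDist_simulates (P : PTSS L A) {lam c : ℝ≥0∞} {s t : Proc L}
    (h : P.bisimDist lam s t ≤ c) (hc : c < 1) :
    Simulates P.trans lam (P.bisimDist lam) c s t :=
  Simulates.mono ((P.isLeast_bisimDist lam).1.transfer s t (h.trans_lt hc)) (fun _ _ => le_rfl) h

theorem PTSS.bisimDist_le_of_simulates (P : PTSS L A) {lam c : ℝ≥0∞} {s t : Proc L}
    (h₁ : c < 1 → Simulates P.trans lam (P.bisimDist lam) c s t)
    (h₂ : c < 1 → Simulates P.trans lam (P.bisimDist lam) c t s) : P.bisimDist lam s t ≤ c := by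
  have e : (fun x y => P.bisimDist lam y x) = P.bisimDist lam :=
    funext₂ fun x y => P.bisimDist_symm lam y x
  rw [← e] at h₂
  rw [P.bisimDist_eq_leastPreBisim] at *
  exact leastPreBisim_le_of_simulates P.finite_trans h₁ h₂

end Model

/-! ### The operators of the process algebra -/

section ProcessAlgebra

variable {A : Type u} {tick : A} {L : FirstOrder.Language.{v, w}} {φ : paLang A →ᴸ L}
  {P : PTSS L A}

/-- Disjointness rules out extra rules for the operators of the algebra, so their transitions are
read off `paRules`. -/
theorem IsDisjointExtension.trans_func_iff (hP : IsDisjointExtension φ (paPTSS tick) P) {n : ℕ}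
    (f : PAOp A n) (ts : Fin n → Proc L) (a : A) (π : PMF (Proc L)) :
    P.trans (.func (φ.onFunction f) ts) a π ↔
      ∃ r ∈ paRules tick f a, ∃ σ, (r.map φ).Derives P.trans ts σ π := by
  rw [P.trans_func_iff, hP.rules_eq, Set.exists_mem_image]
  rfl

theorem IsDisjointExtension.trans_pre_iff (hP : IsDisjointExtension φ (paPTSS tick) P) {n : ℕ}
    (b : A) (p : PMF (Fin n)) (hp : ∀ i, 0 < p i) (ts : Fin n → Proc L) (a : A)
    (π : PMF (Proc L)) :
    P.trans (.func (φ.onFunction (PAOp.pre b p hp)) ts) a π ↔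
      a = b ∧ π = p.bind fun i => PMF.pure (ts i) := by
  rw [hP.trans_func_iff]
  constructor
  · rintro ⟨r, ⟨rfl, rfl⟩, σ, -, -, h⟩
    exact ⟨rfl, h⟩
  · rintro ⟨rfl, rfl⟩
    refine ⟨_, ⟨rfl, rfl⟩, fun q => q.2.elim0, fun i k => k.elim0, fun i b hb => ?_, rfl⟩
    exact (Finset.notMem_empty b hb).elim

/-- Used with `N = ∅` for `+` and `N = {a}` for `+_p`. -/
theorem exists_derives_ruleL_iff (a : A) (N : Finset A) (s t : Proc L) (π : PMF (Proc L)) :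
    (∃ σ, ((ruleL a N fun μ _ _ => μ).map φ).Derives P.trans ![s, t] σ π) ↔
      P.trans s a π ∧ ∀ b ∈ N, ∀ ρ, ¬ P.trans t b ρ := by
  constructor
  · rintro ⟨σ, hpos, hneg, rfl⟩
    exact ⟨hpos 0 (0 : Fin 1), hneg 1⟩
  · rintro ⟨h, hN⟩
    obtain ⟨θ, rfl⟩ := P.exists_denote_of_trans h
    refine ⟨fun _ => θ, ?_, ?_, rfl⟩
    · exact Fin.forall_fin_two.2 ⟨fun _ => h, fun k => Fin.elim0 k⟩
    · exact Fin.forall_fin_two.2 ⟨fun b hb => (Finset.notMem_empty b hb).elim, hN⟩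

theorem exists_derives_ruleR_iff (a : A) (N : Finset A) (s t : Proc L) (π : PMF (Proc L)) :
    (∃ σ, ((ruleR a N fun ν _ _ => ν).map φ).Derives P.trans ![s, t] σ π) ↔
      P.trans t a π ∧ ∀ b ∈ N, ∀ ρ, ¬ P.trans s b ρ := by
  constructor
  · rintro ⟨σ, hpos, hneg, rfl⟩
    exact ⟨hpos 1 (0 : Fin 1), hneg 0⟩
  · rintro ⟨h, hN⟩
    obtain ⟨θ, rfl⟩ := P.exists_denote_of_trans h
    refine ⟨fun _ => θ, ?_, ?_, rfl⟩
    · exact Fin.forall_fin_two.2 ⟨fun k => Fin.elim0 k, fun _ => h⟩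
    · exact Fin.forall_fin_two.2 ⟨hN, fun b hb => (Finset.notMem_empty b hb).elim⟩

/-- The mixture `μ ⊕_p ν` of distributions. -/
def mix {T : Type u} (p : ℝ≥0∞) (h1 : p < 1) (μ ν : PMF T) : PMF T :=
  (PMF.ofFintype ![p, 1 - p] (by simp [h1.le])).bind ![μ, ν]

theorem kantorovich_mix_le {T : Type u} (d : T → T → ℝ≥0∞) {p : ℝ≥0∞} (h1 : p < 1)
    {μ ν μ' ν' : PMF T} {c : ℝ≥0∞} (hμ : kantorovich d μ μ' ≤ c) (hν : kantorovich d ν ν' ≤ c) :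
    kantorovich d (mix p h1 μ ν) (mix p h1 μ' ν') ≤ c :=
  kantorovich_bind_le d _ _ _ (Fin.forall_fin_two.2 ⟨hμ, hν⟩)

theorem denote_choice {p : ℝ≥0∞} (h0 : 0 < p) (h1 : p < 1) (θ₁ θ₂ : CDTerm L) :
    CDTerm.denote (DTerm.choice p h0 h1 θ₁ θ₂) =
      mix p h1 (CDTerm.denote θ₁) (CDTerm.denote θ₂) := by
  simp only [DTerm.choice, CDTerm.denote, mix]
  congr 1
  exact funext (Fin.forall_fin_two.2 ⟨rfl, rfl⟩)

theorem DTerm.subst_map_choice {V W V' W' : Type} {p : ℝ≥0∞} (h0 : 0 < p) (h1 : p < 1)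
    (θ₁ θ₂ : DTerm (paLang A) V W) (σs : V → L.Term V') (σd : W → DTerm L V' W') :
    ((DTerm.choice p h0 h1 θ₁ θ₂).map φ).subst σs σd =
      DTerm.choice p h0 h1 ((θ₁.map φ).subst σs σd) ((θ₂.map φ).subst σs σd) := by
  simp only [DTerm.choice, DTerm.map, DTerm.subst]
  congr 1
  exact funext (Fin.forall_fin_two.2 ⟨rfl, rfl⟩)

theorem exists_derives_choice_iff {p : ℝ≥0∞} (h0 : 0 < p) (h1 : p < 1) (a : A) (s t : Proc L)
    (π : PMF (Proc L)) :
    (∃ σ, ((ruleLR a a fun μ ν _ _ => .choice p h0 h1 μ ν).map φ).Derives P.trans ![s, t] σ π) ↔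
      ∃ μ ν, P.trans s a μ ∧ P.trans t a ν ∧ π = mix p h1 μ ν := by
  constructor
  · rintro ⟨σ, hpos, -, h⟩
    refine ⟨_, _, hpos 0 (0 : Fin 1), hpos 1 (0 : Fin 1), h.trans ?_⟩
    refine (congrArg CDTerm.denote (DTerm.subst_map_choice h0 h1 _ _ _ _)).trans ?_
    exact denote_choice h0 h1 _ _
  · rintro ⟨μ, ν, hs, ht, rfl⟩
    obtain ⟨θ₁, rfl⟩ := P.exists_denote_of_trans hs
    obtain ⟨θ₂, rfl⟩ := P.exists_denote_of_trans ht
    refine ⟨fun q => ![θ₁, θ₂] q.1, ?_, ?_, ?_⟩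
    · exact Fin.forall_fin_two.2 ⟨fun _ => hs, fun _ => ht⟩
    · exact fun i b hb => (Finset.notMem_empty b hb).elim
    · refine (denote_choice h0 h1 _ _).symm.trans ?_
      exact (congrArg CDTerm.denote (DTerm.subst_map_choice (φ := φ) (W := Σ _ : Fin 2, Fin 1) h0 h1
        (.var ⟨0, 0⟩) (.var ⟨1, 0⟩) ![s, t] fun q => ![θ₁, θ₂] q.1)).symm

theorem IsDisjointExtension.trans_alt_iff (hP : IsDisjointExtension φ (paPTSS tick) P)
    (s t : Proc L) (a : A) (π : PMF (Proc L)) :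
    P.trans (.func (φ.onFunction PAOp.alt) ![s, t]) a π ↔ P.trans s a π ∨ P.trans t a π := by
  rw [hP.trans_func_iff]
  simp only [paRules, Set.mem_union, Set.mem_singleton_iff, or_and_right, exists_or,
    exists_eq_left, exists_derives_ruleL_iff, exists_derives_ruleR_iff, Finset.notMem_empty,
    false_imp_iff, implies_true, and_true]

theorem IsDisjointExtension.trans_palt_iff (hP : IsDisjointExtension φ (paPTSS tick) P)
    {p : ℝ≥0∞} (h0 : 0 < p) (h1 : p < 1) (s t : Proc L) (a : A) (π : PMF (Proc L)) :
    P.trans (.func (φ.onFunction (PAOp.palt p h0 h1)) ![s, t]) a π ↔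
      ((P.trans s a π ∧ ∀ ρ, ¬ P.trans t a ρ) ∨ (P.trans t a π ∧ ∀ ρ, ¬ P.trans s a ρ)) ∨
        ∃ μ ν, P.trans s a μ ∧ P.trans t a ν ∧ π = mix p h1 μ ν := by
  rw [hP.trans_func_iff]
  simp only [paRules, Set.mem_union, Set.mem_singleton_iff, or_and_right, exists_or,
    exists_eq_left, exists_derives_ruleL_iff, exists_derives_ruleR_iff,
    exists_derives_choice_iff, Finset.mem_singleton, forall_eq]

/-! ### Simulations between composed processes. -/

variable {lam : ℝ≥0∞}

theorem IsDisjointExtension.simulates_pre (hP : IsDisjointExtension φ (paPTSS tick) P) {n : ℕ}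
    (a : A) (p : PMF (Fin n)) (hp : ∀ i, 0 < p i) (s t : Fin n → Proc L)
    (d : Proc L → Proc L → ℝ≥0∞) :
    Simulates P.trans lam d (lam * ∑ i, p i * d (s i) (t i))
      (.func (φ.onFunction (PAOp.pre a p hp)) s) (.func (φ.onFunction (PAOp.pre a p hp)) t) := by
  intro b π hπ
  obtain ⟨rfl, rfl⟩ := (hP.trans_pre_iff a p hp s b π).1 hπ
  refine ⟨_, (hP.trans_pre_iff b p hp t b _).2 ⟨rfl, rfl⟩, mul_le_mul_right ?_ _⟩
  exact (kantorovich_bind_pure d p s t).trans_eq (tsum_fintype _)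

theorem IsDisjointExtension.simulates_alt (hP : IsDisjointExtension φ (paPTSS tick) P)
    {d : Proc L → Proc L → ℝ≥0∞} {c : ℝ≥0∞} {s₁ s₂ t₁ t₂ : Proc L}
    (h₁ : Simulates P.trans lam d c s₁ t₁) (h₂ : Simulates P.trans lam d c s₂ t₂) :
    Simulates P.trans lam d c (.func (φ.onFunction PAOp.alt) ![s₁, s₂])
      (.func (φ.onFunction PAOp.alt) ![t₁, t₂]) := by
  intro a π hπ
  simp only [hP.trans_alt_iff] at hπ ⊢
  rcases hπ with hπ | hπ
  · obtain ⟨π', hπ', h⟩ := h₁ a π hπ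
    exact ⟨π', Or.inl hπ', h⟩
  · obtain ⟨π', hπ', h⟩ := h₂ a π hπ
    exact ⟨π', Or.inr hπ', h⟩

theorem IsDisjointExtension.simulates_palt (hP : IsDisjointExtension φ (paPTSS tick) P)
    (hlam0 : lam ≠ 0) (hlam : lam ≠ ∞) {p : ℝ≥0∞} (h0 : 0 < p) (h1 : p < 1)
    {d : Proc L → Proc L → ℝ≥0∞} {c : ℝ≥0∞} {s₁ s₂ t₁ t₂ : Proc L}
    (h₁ : Simulates P.trans lam d c s₁ t₁) (h₁' : Simulates P.trans lam d c t₁ s₁)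
    (h₂ : Simulates P.trans lam d c s₂ t₂) (h₂' : Simulates P.trans lam d c t₂ s₂) :
    Simulates P.trans lam d c (.func (φ.onFunction (PAOp.palt p h0 h1)) ![s₁, s₂])
      (.func (φ.onFunction (PAOp.palt p h0 h1)) ![t₁, t₂]) := by
  intro a π hπ
  simp only [hP.trans_palt_iff] at hπ ⊢
  rcases hπ with (⟨hπ, hn⟩ | ⟨hπ, hn⟩) | ⟨μ, ν, hμ, hν, rfl⟩
  · obtain ⟨π', hπ', h⟩ := h₁ a π hπ
    refine ⟨π', Or.inl (Or.inl ⟨hπ', fun ρ hρ => ?_⟩), h⟩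
    -- The negative premise transfers through the reverse simulation: an `a`-move of `t₂` would
    -- force one of `s₂`.
    obtain ⟨ρ', hρ', -⟩ := h₂' a ρ hρ
    exact hn ρ' hρ'
  · obtain ⟨π', hπ', h⟩ := h₂ a π hπ
    refine ⟨π', Or.inl (Or.inr ⟨hπ', fun ρ hρ => ?_⟩), h⟩
    obtain ⟨ρ', hρ', -⟩ := h₁' a ρ hρ
    exact hn ρ' hρ'
  · obtain ⟨μ', hμ', hμle⟩ := h₁ a μ hμ
    obtain ⟨ν', hν', hνle⟩ := h₂ a ν hν
    refine ⟨mix p h1 μ' ν', Or.inr ⟨μ', ν', hμ', hν', rfl⟩, ?_⟩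
    -- Dividing by `lam` turns the bounds into `c / lam` on the Kantorovich distances themselves,
    -- which mixtures preserve.
    rw [mul_comm, ← ENNReal.le_div_iff_mul_le (Or.inl hlam0) (Or.inl hlam)] at hμle hνle ⊢
    exact kantorovich_mix_le d h1 hμle hνle

end ProcessAlgebra

end PPA

end

theorem mainTheorem3 {A : Type*} (tick : A) {L : FirstOrder.Language}
    (φ : PPA.paLang A →ᴸ L) (P : PPA.PTSS L A)
    (hP : PPA.IsDisjointExtension φ (PPA.paPTSS tick) P)
    (lam : ℝ≥0∞) (hlam0 : 0 < lam) (hlam1 : lam ≤ 1) :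
    IsLeast {d | PPA.IsBisimMetric P.trans lam d} (P.bisimDist lam) ∧
    (∀ {n : ℕ} (a : A) (p : PMF (Fin n)) (hp : ∀ i, 0 < p i) (s t : Fin n → PPA.Proc L),
      P.bisimDist lam (.func (φ.onFunction (PPA.PAOp.pre a p hp)) s)
          (.func (φ.onFunction (PPA.PAOp.pre a p hp)) t) ≤
        lam * ∑ i, p i * P.bisimDist lam (s i) (t i)) ∧
    (∀ s₁ s₂ t₁ t₂ : PPA.Proc L,
      P.bisimDist lam (.func (φ.onFunction PPA.PAOp.alt) ![s₁, s₂])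
          (.func (φ.onFunction PPA.PAOp.alt) ![t₁, t₂]) ≤
        max (P.bisimDist lam s₁ t₁) (P.bisimDist lam s₂ t₂)) ∧
    (∀ (p : ℝ≥0∞) (h0 : 0 < p) (h1 : p < 1) (s₁ s₂ t₁ t₂ : PPA.Proc L),
      P.bisimDist lam (.func (φ.onFunction (PPA.PAOp.palt p h0 h1)) ![s₁, s₂])
          (.func (φ.onFunction (PPA.PAOp.palt p h0 h1)) ![t₁, t₂]) ≤
        max (P.bisimDist lam s₁ t₁) (P.bisimDist lam s₂ t₂)) := by
  have hsymm := P.bisimDist_symm lam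
  refine ⟨P.isLeast_bisimDist lam, fun a p hp s t => ?_, fun s₁ s₂ t₁ t₂ => ?_,
    fun p h0 h1 s₁ s₂ t₁ t₂ => ?_⟩
  · refine P.bisimDist_le_of_simulates (fun _ => hP.simulates_pre a p hp s t _) fun _ => ?_
    -- Symmetry makes the bound on the right that of the reverse simulation.
    simp only [hsymm (s _)]
    exact hP.simulates_pre a p hp t s _
  · exact P.bisimDist_le_of_simulates
      (fun hc => hP.simulates_alt (P.bisimDist_simulates (le_max_left _ _) hc)
        (P.bisimDist_simulates (le_max_right _ _) hc))
      (fun hc => hP.simulates_alt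
        (P.bisimDist_simulates ((hsymm _ _).trans_le (le_max_left _ _)) hc)
        (P.bisimDist_simulates ((hsymm _ _).trans_le (le_max_right _ _)) hc))
  · have h (hc : max (P.bisimDist lam s₁ t₁) (P.bisimDist lam s₂ t₂) < 1) :=
      And.intro (P.bisimDist_simulates (le_max_left _ _) hc)
        (P.bisimDist_simulates ((hsymm _ _).trans_le (le_max_left _ _)) hc)
    have h' (hc : max (P.bisimDist lam s₁ t₁) (P.bisimDist lam s₂ t₂) < 1) :=
      And.intro (P.bisimDist_simulates (le_max_right _ _) hc)
        (P.bisimDist_simulates ((hsymm _ _).trans_le (le_max_right _ _)) hc)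
    have hlam : lam ≠ ∞ := (hlam1.trans_lt ENNReal.one_lt_top).ne
    exact P.bisimDist_le_of_simulates
      (fun hc => hP.simulates_palt hlam0.ne' hlam h0 h1 (h hc).1 (h hc).2 (h' hc).1 (h' hc).2)
      (fun hc => hP.simulates_palt hlam0.ne' hlam h0 h1 (h hc).2 (h hc).1 (h' hc).2 (h' hc).1)
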